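/- For a positive integer $N$ let $H_N=\{(x,y)\in\mathbb{R}^2: xy\ge N,\ x,y>0\}$, and for $K\subset\mathbb{R}^2$ let $I(K)=\mathrm{conv}(\mathbb{Z}^2\cap K)$ denote its integer hull. Put $N_1=\lfloor N^{1/3}\rfloor$, $N_2=\lceil N/N_1\rceil$, $Q_N=H_N\cap[1,N_2]^2$ and $A_N=\mathrm{Area}(Q_N\setminus I(Q_N))$. Then there are absolute constants $c,C>0$ such that for every integer $N\ge 2$ \[ c\,N^{1/3}\log N< A_N< C\,N^{1/3}\log N . \] -/

import Mathlib

noncomputable section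

/-- The convex region `{(x, y) : x y ≥ N, x > 0, y > 0}` above the hyperbola `x y = N`. -/
def hyperbolaRegion (N : ℕ) : Set (ℝ × ℝ) :=
  {p | 0 < p.1 ∧ 0 < p.2 ∧ (N : ℝ) ≤ p.1 * p.2}

/-- The points of the plane with integer coordinates. -/
def latticePoints : Set (ℝ × ℝ) :=
  Set.range fun z : ℤ × ℤ => ((z.1 : ℝ), (z.2 : ℝ))

/-- The integer hull of a planar set: the convex hull of its lattice points. -/
def integerHull (K : Set (ℝ × ℝ)) : Set (ℝ × ℝ) :=
  convexHull ℝ (latticePoints ∩ K)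

/-- `N₁ = ⌊N^(1/3)⌋`. -/
def cutLow (N : ℕ) : ℕ := ⌊(N : ℝ) ^ (1 / 3 : ℝ)⌋₊

/-- `N₂ = ⌈N / N₁⌉` (real division inside the ceiling). -/
def cutHigh (N : ℕ) : ℕ := ⌈(N : ℝ) / (cutLow N : ℝ)⌉₊

/-- `Q_N`: the part of the region above the hyperbola lying in the square `[1, N₂]²`. -/
def truncatedRegion (N : ℕ) : Set (ℝ × ℝ) :=
  hyperbolaRegion N ∩ Set.Icc (1 : ℝ) (cutHigh N : ℝ) ×ˢ Set.Icc (1 : ℝ) (cutHigh N : ℝ)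

/-- `A_N`: the area (planar Lebesgue measure) of `Q_N` minus its integer hull. -/
def missedArea (N : ℕ) : ℝ :=
  (MeasureTheory.volume (truncatedRegion N \ integerHull (truncatedRegion N))).toReal

end

open MeasureTheory Set

/-! Put T = N^(1/3) and cut the abscissae into dyadic blocks [LT, 2LT]. The missed area in a block
has order T: the hull typically stays about 1/L above the hyperbola, over a length LT. By reflection
in the diagonal only abscissae up to about √N matter, so L runs up to about √T and there are about
log T blocks.

Upper bound: approximate the slope N/x² by a/q. A lattice line of slope -a/q placed just above the
tangent at x carries lattice points spaced q apart horizontally, and the chord around x lies at most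
1/q + (slope error)·q + 2q²/L³ above the hyperbola (`mem_integerHull_of_slope`). With q of order L
this is O(1/L). A larger gap, of size 4^j/L, forces q ≤ L/4^j, hence a slope close to a rational of
small denominator. Such x form the set `slopeArcs`, whose measure is small enough for the areas to
sum geometrically in j (`volume_missedSet_block_le`).

Lower bound: if no lattice point of the region with abscissa within a small multiple of L of x is
closer than η ~ 1/L to the hyperbola, the shifted tangent at x separates the hull from the curve
(`notMem_integerHull_of_gap`). Two neighbouring columns with such close lattice points again put the
slope in `slopeArcs`, and isolated columns are few, so half of each block is good
(`volume_nearAbscissaSet_le`).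

Small N need only positivity and finiteness of the area. -/

/-! ### Strips above the hyperbola and criteria for membership in the hull. -/

/-- The points over `E` lying at height at most `h` above the hyperbola `x y = N`. -/
def hyperbolaStrip (N : ℕ) (E : Set ℝ) (h : ℝ) : Set (ℝ × ℝ) :=
  {p | p.1 ∈ E ∧ (N : ℝ) / p.1 ≤ p.2 ∧ p.2 ≤ N / p.1 + h}

theorem volume_hyperbolaStrip (N : ℕ) {E : Set ℝ} (hE : MeasurableSet E) (h : ℝ) :
    volume (hyperbolaStrip N E h) = ENNReal.ofReal h * volume E := by
  have hf : Measurable fun p : ℝ × ℝ => (N : ℝ) / p.1 := measurable_const.div measurable_fst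
  have hm : MeasurableSet (hyperbolaStrip N E h) :=
    (measurable_fst hE).inter ((measurableSet_le hf measurable_snd).inter
      (measurableSet_le measurable_snd (hf.add_const h)))
  rw [Measure.volume_eq_prod, Measure.prod_apply hm]
  have : ∀ x : ℝ, volume (Prod.mk x ⁻¹' hyperbolaStrip N E h)
      = E.indicator (fun _ => ENNReal.ofReal h) x := by
    intro x
    by_cases hx : x ∈ E
    · have : Prod.mk x ⁻¹' hyperbolaStrip N E h = Icc ((N : ℝ) / x) (N / x + h) := by
        ext y; simp [hyperbolaStrip, hx]
      rw [this, Real.volume_Icc, indicator_of_mem hx]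
      congr 1; ring
    · have : Prod.mk x ⁻¹' hyperbolaStrip N E h = ∅ := by
        ext y; simp [hyperbolaStrip, hx]
      rw [this, indicator_of_notMem hx, measure_empty]
  simp_rw [this]
  rw [lintegral_indicator hE, setLIntegral_const]

theorem hyperbolaStrip_mono (N : ℕ) {E F : Set ℝ} (h : E ⊆ F) (t : ℝ) :
    hyperbolaStrip N E t ⊆ hyperbolaStrip N F t :=
  fun _ hp => ⟨h hp.1, hp.2⟩

theorem volume_hyperbolaStrip_le (N : ℕ) (E : Set ℝ) (h : ℝ) :
    volume (hyperbolaStrip N E h) ≤ ENNReal.ofReal h * volume E := by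
  rw [← measure_toMeasurable E, ← volume_hyperbolaStrip N (measurableSet_toMeasurable _ _) h]
  exact measure_mono (hyperbolaStrip_mono N (subset_toMeasurable _ _) h)

/-- Second-order expansion of `N / u` at `x`, with exact remainder. -/
theorem div_expansion (N : ℝ) {x u : ℝ} (hx : x ≠ 0) (hu : u ≠ 0) :
    N / u = N / x - N / x ^ 2 * (u - x) + N * (u - x) ^ 2 / (x ^ 2 * u) := by
  field_simp; ring

/-- The side `cutHigh N` is an integer, so both columns have their top lattice point in the region;
the hull then contains everything vertically between the chord and the top edge. -/
theorem mem_integerHull_of_above {N : ℕ} {x₁ x₂ v₁ v₂ : ℤ}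
    (h₁ : ((x₁ : ℝ), (v₁ : ℝ)) ∈ truncatedRegion N)
    (h₂ : ((x₂ : ℝ), (v₂ : ℝ)) ∈ truncatedRegion N) {α β x y : ℝ}
    (hα : 0 ≤ α) (hβ : 0 ≤ β) (hαβ : α + β = 1) (hx : α * x₁ + β * x₂ = x)
    (hy : α * v₁ + β * v₂ ≤ y) (hyN : y ≤ cutHigh N) :
    (x, y) ∈ integerHull (truncatedRegion N) := by
  have top : ∀ {u v : ℤ}, ((u : ℝ), (v : ℝ)) ∈ truncatedRegion N →
      ((u : ℝ), (cutHigh N : ℝ)) ∈ integerHull (truncatedRegion N) := by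
    rintro u v ⟨⟨h1, h2, h3⟩, ⟨h4, h5⟩, h6, h7⟩
    refine subset_convexHull ℝ _ ⟨⟨(u, (cutHigh N : ℤ)), by simp⟩, ⟨h1, ?_, ?_⟩, ⟨h4, h5⟩, ?_, le_rfl⟩
    · exact h2.trans_le h7
    · exact h3.trans (mul_le_mul_of_nonneg_left h7 h1.le)
    · exact le_trans h6 h7
  have bot : ∀ {u v : ℤ}, ((u : ℝ), (v : ℝ)) ∈ truncatedRegion N →
      ((u : ℝ), (v : ℝ)) ∈ integerHull (truncatedRegion N) := fun {u v} h =>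
    subset_convexHull ℝ _ ⟨⟨(u, v), rfl⟩, h⟩
  have hc : Convex ℝ (integerHull (truncatedRegion N)) := convex_convexHull ℝ _
  have a1 := hc (bot h₁) (bot h₂) hα hβ hαβ
  have a2 := hc (top h₁) (top h₂) hα hβ hαβ
  simp only [Prod.smul_mk, smul_eq_mul, Prod.mk_add_mk, hx] at a1 a2
  rw [← add_mul, hαβ, one_mul] at a2
  rcases eq_or_lt_of_le hyN with rfl | hlt
  · exact a2
  have hd : 0 < (cutHigh N : ℝ) - (α * v₁ + β * v₂) := by linarith
  have hs := hc a1 a2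
    (a := (cutHigh N - y) / (cutHigh N - (α * v₁ + β * v₂)))
    (b := (y - (α * v₁ + β * v₂)) / (cutHigh N - (α * v₁ + β * v₂)))
    (by apply div_nonneg <;> linarith) (by apply div_nonneg <;> linarith)
    (by rw [← add_div, div_eq_one_iff_eq hd.ne']; ring)
  convert hs using 1
  ext
  · have : (cutHigh N - y + (y - (α * v₁ + β * v₂))) / (cutHigh N - (α * v₁ + β * v₂)) = 1 := by
      rw [div_eq_one_iff_eq hd.ne']; ring
    simp only [Prod.smul_mk, smul_eq_mul, Prod.mk_add_mk]
    rw [← add_mul, ← add_div, this, one_mul]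
  · simp only [Prod.smul_mk, smul_eq_mul, Prod.mk_add_mk]
    field_simp
    ring

/-- If no lattice point of the region near the abscissa `x` is within `η` of the hyperbola, then
the hull stays at distance more than `η` above the hyperbola at `x`. -/
theorem notMem_integerHull_of_gap {N : ℕ} {x r η y : ℝ} (hx : 0 < x) (hr : 0 < r)
    (hη : η * (x ^ 2 * (x + r)) ≤ N * r ^ 2)
    (hgap : ∀ m n : ℤ, 0 < m → |(m : ℝ) - x| ≤ r → (N : ℝ) / m ≤ n → η < n - (N : ℝ) / m)
    (hy : y < N / x + η) (K : Set (ℝ × ℝ)) (hK : K ⊆ hyperbolaRegion N) :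
    (x, y) ∉ integerHull K := by
  -- The half-plane above the tangent at `x` raised by `η`. Near lattice points lie in it by the gap
  -- hypothesis and convexity, far ones by the quadratic remainder alone.
  set S : Set (ℝ × ℝ) := {p | η ≤ p.2 - (N / x - N / x ^ 2 * (p.1 - x))} with hS
  have hconv : Convex ℝ S := by
    intro p hp q hq a b ha hb hab
    simp only [hS, mem_ofPred_eq, Prod.snd_add, Prod.fst_add, Prod.smul_fst, Prod.smul_snd,
      smul_eq_mul] at *
    have h1 := mul_le_mul_of_nonneg_left hp ha
    have h2 := mul_le_mul_of_nonneg_left hq hb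
    have h3 : (a + b) * η = η := by rw [hab, one_mul]
    have h4 : (a + b) * (N / x + N / x ^ 2 * x) = N / x + N / x ^ 2 * x := by rw [hab, one_mul]
    linarith
  have hsub : integerHull K ⊆ S := by
    refine convexHull_min ?_ hconv
    rintro _ ⟨⟨⟨m, n⟩, rfl⟩, hz⟩
    obtain ⟨hm, hn, hmn⟩ := hK hz
    simp only at hm hn hmn
    simp only [hS, mem_ofPred_eq]
    have hle : (N : ℝ) / m ≤ n := by rw [div_le_iff₀ hm]; linarith
    have hexp := div_expansion N hx.ne' hm.ne'
    have hrem : 0 ≤ (N : ℝ) * (m - x) ^ 2 / (x ^ 2 * m) := by positivity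
    by_cases hc : |(m : ℝ) - x| ≤ r
    · have := hgap m n (by exact_mod_cast hm) hc hle
      linarith
    · push Not at hc
      have key : η ≤ (N : ℝ) * (m - x) ^ 2 / (x ^ 2 * m) := by
        rw [le_div_iff₀ (by positivity)]
        have hN : (0 : ℝ) ≤ N := Nat.cast_nonneg N
        -- Beyond distance `r` the quotient (m - x)²/m is at least its value at m = x + r, the
        -- weaker of the two endpoints.
        have : r ^ 2 * m ≤ (m - x) ^ 2 * (x + r) := by
          rcases lt_abs.1 hc with h | h
          · nlinarith [mul_pos hr hx, mul_pos (sub_pos.2 h) hr, mul_pos (sub_pos.2 h) hx, mul_pos (mul_pos (sub_pos.2 h) hr) hx, mul_pos (mul_pos (sub_pos.2 h) hr) hr, mul_pos (mul_pos (sub_pos.2 h) (sub_pos.2 h)) hr,  mul_pos (mul_pos (sub_pos.2 h) (sub_pos.2 h)) hx]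
          · have : r ^ 2 ≤ (m - x) ^ 2 := by nlinarith
            nlinarith [mul_pos hr hr, mul_nonneg (sub_nonneg.2 this) hx.le]
        have hxr : 0 < x + r := by linarith
        have h1 := mul_le_mul_of_nonneg_left this hN
        have h2 := mul_le_mul_of_nonneg_right hη hm.le
        have : η * (x ^ 2 * m) * (x + r) ≤ N * (m - x) ^ 2 * (x + r) := by linarith
        exact le_of_mul_le_mul_right this hxr
      linarith
  intro h
  have := hsub h
  simp only [hS, mem_ofPred_eq, sub_self, mul_zero, sub_zero] at this
  linarith

/-! ### Size of the truncation parameters. -/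

theorem cutLow_bounds {N : ℕ} {T : ℝ} (hT : 0 < T) (hTN : T ^ 3 = N) :
    (cutLow N : ℝ) ≤ T ∧ T < cutLow N + 1 := by
  have : (N : ℝ) ^ (1 / 3 : ℝ) = T := by
    rw [← hTN, ← Real.rpow_natCast, ← Real.rpow_mul hT.le]; norm_num
  unfold cutLow
  rw [this]
  exact ⟨Nat.floor_le hT.le, Nat.lt_floor_add_one _⟩

theorem cutHigh_bounds (N : ℕ) :
    (N : ℝ) / cutLow N ≤ cutHigh N ∧ (cutHigh N : ℝ) < N / cutLow N + 1 :=
  ⟨Nat.le_ceil _, Nat.ceil_lt_add_one (by positivity)⟩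

theorem sq_le_cutHigh {N : ℕ} {T : ℝ} (hT : 1 ≤ T) (hTN : T ^ 3 = N) : T ^ 2 ≤ cutHigh N := by
  obtain ⟨h1, h2⟩ := cutLow_bounds (by linarith) hTN
  have h0 : 0 < (cutLow N : ℝ) := by linarith
  refine le_trans ?_ (cutHigh_bounds N).1
  rw [le_div_iff₀ h0, ← hTN]
  nlinarith [mul_le_mul_of_nonneg_left h1 (sq_nonneg T)]

theorem one_le_cutLow {N : ℕ} {T : ℝ} (hT : 1 ≤ T) (hTN : T ^ 3 = N) : 1 ≤ cutLow N := by
  obtain ⟨h1, h2⟩ := cutLow_bounds (by linarith) hTN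
  have : (0 : ℝ) < (cutLow N : ℝ) := by linarith
  exact_mod_cast this

/-! ### Measure of the set where the slope is close to a rational of small denominator. -/

/-- The points of `[X, 2X]` at which some multiple by `g ≤ G` of the slope `N / x ^ 2` is within
`w` of an integer. -/
def slopeArcs (N : ℕ) (X : ℝ) (G : ℕ) (w : ℝ) : Set ℝ :=
  {x | x ∈ Icc X (2 * X) ∧ ∃ g ∈ Finset.Icc 1 G, ∃ b : ℤ, |(g : ℝ) * (N / x ^ 2) - b| ≤ w}

/-- On the block g·N/x² varies at rate at least gN/(8X³), so a window of width 2w pulls back to a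
set of small diameter. -/
theorem volume_slopeArc_le {N g : ℕ} {X w : ℝ} (hX : 0 < X) (hN : 0 < N) (hg : 1 ≤ g)
    (b : ℝ) : volume {x | x ∈ Icc X (2 * X) ∧ |(g : ℝ) * (N / x ^ 2) - b| ≤ w} ≤
      ENNReal.ofReal (16 * w * X ^ 3 / (N * g)) := by
  refine (Real.volume_le_diam _).trans (Metric.ediam_le ?_)
  rintro x ⟨⟨hx1, hx2⟩, hxb⟩ y ⟨⟨hy1, hy2⟩, hyb⟩
  rw [edist_dist]
  apply ENNReal.ofReal_le_ofReal
  have hg' : (0 : ℝ) < g := by exact_mod_cast hg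
  have hN' : (0 : ℝ) < N := by exact_mod_cast hN
  have hxp : 0 < x := by linarith
  have hyp : 0 < y := by linarith
  rw [Real.dist_eq, le_div_iff₀ (by positivity)]
  have h1 : |(g : ℝ) * (N / x ^ 2) - g * (N / y ^ 2)| ≤ 2 * w := by
    rw [abs_le] at *
    constructor <;> linarith
  have h2 : (g : ℝ) * (N / x ^ 2) - g * (N / y ^ 2)
      = (y - x) * (N * g * (x + y) / (x ^ 2 * y ^ 2)) := by
    field_simp; ring
  rw [h2, abs_mul, abs_sub_comm, abs_of_pos (a := N * g * (x + y) / (x ^ 2 * y ^ 2))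
    (by positivity)] at h1
  have h3 : N * g / (8 * X ^ 3) ≤ N * g * (x + y) / (x ^ 2 * y ^ 2) := by
    rw [div_le_div_iff₀ (by positivity) (by positivity), mul_assoc ((N : ℝ) * g)]
    apply mul_le_mul_of_nonneg_left _ (by positivity)
    have a1 : x ^ 2 ≤ 4 * X ^ 2 := by nlinarith
    have a2 : y ^ 2 ≤ 4 * X ^ 2 := by nlinarith
    have a3 : x ^ 2 * y ^ 2 ≤ 4 * X ^ 2 * (4 * X ^ 2) := mul_le_mul a1 a2 (by positivity) (by positivity)
    have a4 : 2 * X * (8 * X ^ 3) ≤ (x + y) * (8 * X ^ 3) :=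
      mul_le_mul_of_nonneg_right (by linarith) (by positivity)
    linarith
  have h4 := (mul_le_mul_of_nonneg_left h3 (abs_nonneg (x - y))).trans h1
  rw [mul_div_assoc', div_le_iff₀ (by positivity)] at h4
  linarith

/-- For fixed g there are O(gN/X²) possible integers, each with an arc of length O(wX³/(Ng)); the
product O(Xw) does not depend on g. -/
theorem volume_slopeArcs_le {N G : ℕ} {X w : ℝ} (hX : 0 < X) (hXN : X ^ 2 ≤ 4 * N)
    (hw0 : 0 ≤ w) (hw : w < 1) :
    volume (slopeArcs N X G w) ≤ ENNReal.ofReal (144 * X * G * w) := by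
  have hN' : (0 : ℝ) < N := by
    have : 0 < X ^ 2 := by positivity
    linarith
  have hN : 0 < N := by exact_mod_cast hN'
  have hsub : slopeArcs N X G w ⊆ ⋃ g ∈ Finset.Icc 1 G,
      ⋃ b ∈ Finset.range (⌊(g : ℝ) * (N / X ^ 2) + 1⌋₊ + 1),
        {x | x ∈ Icc X (2 * X) ∧ |(g : ℝ) * (N / x ^ 2) - (b : ℕ)| ≤ w} := by
    rintro x ⟨hx, g, hg, b, hb⟩
    have hxp : 0 < x := by linarith [hx.1]
    have hg' : (0 : ℝ) < g := by exact_mod_cast (Finset.mem_Icc.1 hg).1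
    have hb0 : 0 ≤ b := by
      have h1 : 0 < (g : ℝ) * (N / x ^ 2) := by positivity
      have h2 := (abs_le.1 hb).2
      have h3 : (-1 : ℝ) < b := by linarith
      have h4 : -1 < b := by exact_mod_cast h3
      omega
    lift b to ℕ using hb0
    simp only [mem_iUnion]
    refine ⟨g, hg, b, ?_, hx, by exact_mod_cast hb⟩
    rw [Finset.mem_range, Nat.lt_add_one_iff]
    apply Nat.le_floor
    have h2 := (abs_le.1 hb).1
    have h3 : (g : ℝ) * (N / x ^ 2) ≤ g * (N / X ^ 2) := by
      gcongr
      exact hx.1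
    push_cast at h2
    linarith
  refine (measure_mono hsub).trans ((measure_biUnion_finset_le _ _).trans ?_)
  have hcol : ∀ g ∈ Finset.Icc 1 G,
      volume (⋃ b ∈ Finset.range (⌊(g : ℝ) * (N / X ^ 2) + 1⌋₊ + 1),
        {x | x ∈ Icc X (2 * X) ∧ |(g : ℝ) * (N / x ^ 2) - (b : ℕ)| ≤ w}) ≤
      ENNReal.ofReal (144 * X * w) := by
    intro g hg
    have hg1 := (Finset.mem_Icc.1 hg).1
    have hg' : (1 : ℝ) ≤ g := by exact_mod_cast hg1
    refine (measure_biUnion_finset_le _ _).trans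
      ((Finset.sum_le_sum fun b _ => volume_slopeArc_le hX hN hg1 _).trans ?_)
    rw [Finset.sum_const, Finset.card_range, nsmul_eq_mul, ← ENNReal.ofReal_natCast,
      ← ENNReal.ofReal_mul (by positivity)]
    apply ENNReal.ofReal_le_ofReal
    -- N/X² ≥ 1/4 lets the additive 2 be absorbed as 8gN/X².
    have hc : ((⌊(g : ℝ) * (N / X ^ 2) + 1⌋₊ + 1 : ℕ) : ℝ) ≤ 9 * (g * (N / X ^ 2)) := by
      push_cast
      have h1 := Nat.floor_le (a := (g : ℝ) * (N / X ^ 2) + 1) (by positivity)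
      have h2 : 1 / 4 ≤ (N : ℝ) / X ^ 2 := by
        rw [div_le_div_iff₀ (by norm_num) (by positivity)]; linarith
      nlinarith
    refine (mul_le_mul_of_nonneg_right hc (by positivity)).trans (le_of_eq ?_)
    field_simp; ring
  refine (Finset.sum_le_sum hcol).trans ?_
  rw [Finset.sum_const, Nat.card_Icc, nsmul_eq_mul, ← ENNReal.ofReal_natCast,
      ← ENNReal.ofReal_mul (by positivity)]
  apply ENNReal.ofReal_le_ofReal
  rw [Nat.add_sub_cancel]
  linarith

/-! ### How far down the hull reaches. -/

/-- Uses the chord between the lowest lattice points over ⌊x⌋ and ⌈x⌉: rounding up costs 1, and the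
quadratic remainder costs at most 8 because N ≤ 8·`cutLow N`³. -/
theorem mem_integerHull_of_add_nine_le {N : ℕ} {T x y : ℝ} (hT : 1 ≤ T) (hTN : T ^ 3 = N)
    (hx : (cutLow N : ℝ) ≤ x) (hx' : x ≤ cutHigh N) (hy : N / x + 9 ≤ y) (hyN : y ≤ cutHigh N) :
    (x, y) ∈ integerHull (truncatedRegion N) := by
  have hN : (0 : ℝ) < N := by rw [← hTN]; positivity
  have hl1 : (1 : ℝ) ≤ cutLow N := by exact_mod_cast one_le_cutLow hT hTN
  have hcube : (N : ℝ) ≤ 8 * (cutLow N : ℝ) ^ 3 := by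
    have h := (cutLow_bounds (by linarith) hTN).2
    have : T ≤ 2 * cutLow N := by linarith
    calc (N : ℝ) = T ^ 3 := hTN.symm
      _ ≤ (2 * cutLow N : ℝ) ^ 3 := by gcongr
      _ = _ := by ring
  have hx0 : 0 < x := by linarith
  have col : ∀ u : ℤ, (cutLow N : ℤ) ≤ u → u ≤ cutHigh N → |(u : ℝ) - x| ≤ 1 →
      ((u : ℝ), ((⌈(N : ℝ) / u⌉ : ℤ) : ℝ)) ∈ truncatedRegion N ∧
      (⌈(N : ℝ) / u⌉ : ℝ) ≤ N / x - N / x ^ 2 * (u - x) + 9 := by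
    intro u hu1 hu2 hux
    have hu1' : (cutLow N : ℝ) ≤ u := by exact_mod_cast hu1
    have hu2' : (u : ℝ) ≤ cutHigh N := by exact_mod_cast hu2
    have hu0 : (0 : ℝ) < u := by linarith
    have hv0 : 0 < ⌈(N : ℝ) / u⌉ := Int.ceil_pos.2 (by positivity)
    have hv1 : (1 : ℝ) ≤ (⌈(N : ℝ) / u⌉ : ℤ) := by exact_mod_cast hv0
    refine ⟨⟨⟨hu0, by linarith, ?_⟩, ⟨by linarith, hu2'⟩, hv1, ?_⟩, ?_⟩
    · have := Int.le_ceil ((N : ℝ) / u)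
      rw [div_le_iff₀ hu0] at this
      simp only; linarith
    · have : ⌈(N : ℝ) / u⌉ ≤ (cutHigh N : ℤ) := by
        rw [Int.ceil_le]
        push_cast
        refine le_trans ?_ (cutHigh_bounds N).1
        gcongr
      have h : ((⌈(N : ℝ) / u⌉ : ℤ) : ℝ) ≤ ((cutHigh N : ℤ) : ℝ) := Int.cast_le.2 this
      rwa [Int.cast_natCast] at h
    · have h1 := (Int.ceil_lt_add_one ((N : ℝ) / u)).le
      have h2 := div_expansion N hx0.ne' hu0.ne'
      have h3 : (N : ℝ) * (u - x) ^ 2 / (x ^ 2 * u) ≤ 8 := by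
        rw [div_le_iff₀ (by positivity)]
        have a1 : ((u : ℝ) - x) ^ 2 ≤ 1 := by rw [sq_le_one_iff_abs_le_one]; exact hux
        have a2 : (cutLow N : ℝ) ^ 3 ≤ x ^ 2 * u := by
          have : (cutLow N : ℝ) ^ 2 ≤ x ^ 2 := by gcongr
          calc (cutLow N : ℝ) ^ 3 = (cutLow N : ℝ) ^ 2 * cutLow N := by ring
            _ ≤ _ := by gcongr
        nlinarith
      linarith
  have hfl : (cutLow N : ℤ) ≤ ⌊x⌋ := by rw [Int.le_floor]; exact_mod_cast hx
  have hce : ⌈x⌉ ≤ (cutHigh N : ℤ) := by rw [Int.ceil_le]; exact_mod_cast hx'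
  have hfc := Int.floor_le_ceil x
  have b1 := Int.floor_le x
  have b2 := Int.lt_floor_add_one x
  have b3 := Int.le_ceil x
  have b4 := Int.ceil_lt_add_one x
  obtain ⟨m1, l1⟩ := col ⌊x⌋ hfl (hfc.trans hce) (by rw [abs_le]; constructor <;> linarith)
  obtain ⟨m2, l2⟩ := col ⌈x⌉ (hfl.trans hfc) hce (by rw [abs_le]; constructor <;> linarith)
  have hcomb : (1 - Int.fract x) * (⌊x⌋ : ℝ) + Int.fract x * (⌈x⌉ : ℝ) = x := by
    by_cases hf : Int.fract x = 0
    · rw [hf]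
      have := Int.floor_add_fract x
      linarith
    · have h1 := Int.ceil_eq_add_one_sub_fract hf
      have h2 := Int.floor_add_fract x
      rw [h1]
      have : (⌊x⌋ : ℝ) = x - Int.fract x := by linarith
      rw [this]; ring
  have f0 := Int.fract_nonneg x
  have f1 := (Int.fract_lt_one x).le
  refine mem_integerHull_of_above m1 m2 (sub_nonneg.2 f1) f0 (by ring) hcomb ?_ hyN
  have e1 := mul_le_mul_of_nonneg_left l1 (sub_nonneg.2 f1)
  have e2 := mul_le_mul_of_nonneg_left l2 f0
  have e3 : (1 - Int.fract x) * (N / x - N / x ^ 2 * (⌊x⌋ - x) + 9)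
      + Int.fract x * (N / x - N / x ^ 2 * (⌈x⌉ - x) + 9)
      = N / x + 9 - N / x ^ 2 * ((1 - Int.fract x) * (⌊x⌋ : ℝ) + Int.fract x * (⌈x⌉ : ℝ) - x) := by
    ring
  rw [hcomb] at e3
  linarith

/-- Over the window |u - x| ≤ q, `d * q` pays for the slope error, `e` for the quadratic remainder,
and 1/q for rounding the intercept so that the line contains lattice points. -/
theorem mem_integerHull_of_slope {N q : ℕ} {a : ℤ} {T X x y d e : ℝ} (hT : 36 ≤ T)
    (hTN : T ^ 3 = N) (hX : 4 * T ≤ X) (hXN : X ^ 2 ≤ 4 * N) (hx : x ∈ Icc X (2 * X))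
    (hq : 0 < q) (hqX : (q : ℝ) ≤ X / 2) (hcop : IsCoprime a (q : ℤ))
    (hd : |(N : ℝ) / x ^ 2 - a / q| ≤ d) (hdq : d * q ≤ 1)
    (he : 2 * N * q ^ 2 / X ^ 3 ≤ e) (he5 : e ≤ 5)
    (hy : N / x + (1 / q + d * q + e) ≤ y) (hyN : y ≤ cutHigh N) :
    (x, y) ∈ integerHull (truncatedRegion N) := by
  obtain ⟨hxX, hxX'⟩ := hx
  have hN : (0 : ℝ) < N := by rw [← hTN]; positivity
  have hX0 : 0 < X := by linarith
  have hx0 : 0 < x := by linarith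
  have hq0 : (0 : ℝ) < q := by exact_mod_cast hq
  have hq1 : (1 : ℝ) ≤ q := by exact_mod_cast hq
  have hN2 := sq_le_cutHigh (by linarith) hTN
  -- Keeps abscissae up to 2X + q inside the square; 9X² ≤ 36T³ ≤ T⁴ is where `36 ≤ T` enters.
  have hX3 : 3 * X ≤ T ^ 2 := by
    apply le_of_sq_le_sq _ (by positivity)
    have : T ^ 4 = T * N := by rw [← hTN]; ring
    nlinarith
  have hd0 : 0 ≤ d := (abs_nonneg _).trans hd
  set c : ℤ := ⌈a * x + q * (N / x + (d * q + e))⌉ with hc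
  have hc1 := Int.le_ceil (a * x + q * (N / x + (d * q + e)))
  have hc2 := (Int.ceil_lt_add_one (a * x + q * (N / x + (d * q + e)))).le
  rw [← hc] at hc1 hc2
  have hlat : ∀ u v : ℤ, a * u + q * v = c → |(u : ℝ) - x| ≤ q →
      ((u : ℝ), (v : ℝ)) ∈ truncatedRegion N := by
    intro u v huv hux
    have huvR : (a : ℝ) * u + q * v = c := by exact_mod_cast huv
    have hux' := abs_le.1 hux
    have hu0 : X / 2 ≤ u := by linarith
    have hupos : (0 : ℝ) < u := by linarith
    have hexp := div_expansion N hx0.ne' hupos.ne'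
    have hrem0 : 0 ≤ (N : ℝ) * (u - x) ^ 2 / (x ^ 2 * u) := by positivity
    have hrem : (N : ℝ) * (u - x) ^ 2 / (x ^ 2 * u) ≤ e := by
      refine le_trans ?_ he
      have h1 : ((u : ℝ) - x) ^ 2 ≤ q ^ 2 := by rw [sq_le_sq, abs_of_pos hq0]; exact hux
      have h2 : X ^ 2 * (X / 2) ≤ x ^ 2 * u := by gcongr
      calc (N : ℝ) * (u - x) ^ 2 / (x ^ 2 * u) ≤ N * q ^ 2 / (X ^ 2 * (X / 2)) := by gcongr
        _ = _ := by field_simp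
    have hslope : |((N : ℝ) / x ^ 2 - a / q) * (u - x)| ≤ d * q := by
      rw [abs_mul]
      exact mul_le_mul hd hux (abs_nonneg _) hd0
    have hs := abs_le.1 hslope
    have hv : (v : ℝ) = (c - a * x) / q - a / q * (u - x) := by
      field_simp; linarith
    have hc1' : N / x + (d * q + e) ≤ (c - a * x) / q := by
      rw [le_div_iff₀ hq0]; linarith
    have hc2' : (c - a * x) / q ≤ N / x + (d * q + e) + 1 / q := by
      rw [div_le_iff₀ hq0, add_mul, one_div_mul_cancel hq0.ne']; linarith
    have hNv : (N : ℝ) / u ≤ v := by rw [hv, hexp]; linarith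
    have hq1' : (1 : ℝ) / q ≤ 1 := by rw [div_le_one hq0]; exact hq1
    -- 8 = 1 + 2 + 5, bounding 1/q, twice `d * q`, and `e`.
    have hvN : (v : ℝ) ≤ N / u + 8 := by rw [hv, hexp]; linarith
    have hNu : (N : ℝ) / u ≤ T ^ 2 / 2 := by
      rw [div_le_iff₀ hupos, ← hTN]
      have : T ^ 2 * (2 * T) ≤ T ^ 2 * u := by gcongr; linarith
      linarith
    have hv0 : (0 : ℝ) < v := lt_of_lt_of_le (by positivity) hNv
    have hv1 : (1 : ℝ) ≤ v := by
      have : 0 < v := by exact_mod_cast hv0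
      exact_mod_cast this
    refine ⟨⟨hupos, hv0, ?_⟩, ⟨by simp only; linarith, by simp only; linarith⟩, hv1, ?_⟩
    · rw [div_le_iff₀ hupos] at hNv
      simp only; linarith
    · simp only; nlinarith
  obtain ⟨s, t, hst⟩ := hcop
  -- Bézout gives the lattice points (sc + qk, tc - ak) of the line; this `k` and `k + 1` bracket
  -- `x`.
  set k : ℤ := ⌊(x - (s * c : ℤ)) / q⌋ with hk
  have hk1 := Int.floor_le ((x - (s * c : ℤ)) / q)
  have hk2 := (Int.lt_floor_add_one ((x - (s * c : ℤ)) / q)).le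
  rw [← hk] at hk1 hk2
  rw [le_div_iff₀ hq0] at hk1
  rw [div_le_iff₀ hq0] at hk2
  have l1 : a * (s * c + q * k) + q * (t * c - a * k) = c := by linear_combination c * hst
  have l2 : a * (s * c + q * (k + 1)) + q * (t * c - a * (k + 1)) = c := by
    linear_combination c * hst
  have m1 := hlat _ _ l1 (by
    push_cast at *
    rw [abs_le]; constructor <;> linarith)
  have m2 := hlat _ _ l2 (by
    push_cast at *
    rw [abs_le]; constructor <;> linarith)
  have l1R : (a : ℝ) * (s * c + q * k) + q * (t * c - a * k) = c := by exact_mod_cast l1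
  push_cast at hk1 hk2
  refine mem_integerHull_of_above m1 m2 (α := 1 - (x - (s * c + q * k)) / q)
    (β := (x - (s * c + q * k)) / q) ?_ ?_ (by ring) ?_ ?_ hyN
  · rw [sub_nonneg, div_le_one hq0]; linarith
  · apply div_nonneg _ hq0.le; linarith
  · push_cast; field_simp; ring
  · refine le_trans ?_ hy
    have hline : ∀ U V : ℝ, a * U + q * V = c →
        (1 - (x - U) / q) * V + (x - U) / q * (V - a) = (c - a * x) / q := by
      intro U V h
      rw [← h]
      field_simp; ring
    have h1 : ((t * c - a * (k + 1) : ℤ) : ℝ) = t * c - a * k - a := by push_cast; ring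
    have h2 : ((t * c - a * k : ℤ) : ℝ) = t * c - a * k := by push_cast; ring
    rw [h1, h2, hline _ _ l1R, div_le_iff₀ hq0]
    have h3 : (N / x + (1 / q + d * q + e)) * q = q * (N / x + (d * q + e)) + 1 / q * q := by ring
    rw [h3, one_div_mul_cancel hq0.ne']
    linarith

/-- Dirichlet with denominators up to 2^j·L keeps the remainder 2q²/L³ below 2·4^j/L. Avoiding the
arcs forces q > L/4^j, so 1/q, the slope error times q, and the remainder total at most 4·4^j/L. -/
theorem mem_integerHull_of_notMem_slopeArcs {N j : ℕ} {T L x y : ℝ} (hT : 36 ≤ T)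
    (hTN : T ^ 3 = N) (hL : 4 ≤ L) (hLT : L ^ 2 ≤ 4 * T) (hj : (4 : ℝ) ^ j ≤ 9 / 4 * L)
    (hx : x ∈ Icc (L * T) (2 * (L * T)))
    (hxa : x ∉ slopeArcs N (L * T) ⌊L / 4 ^ j⌋₊ (1 / (2 ^ j * L)))
    (hy : N / x + 4 * (4 ^ j / L) ≤ y) (hyN : y ≤ cutHigh N) :
    (x, y) ∈ integerHull (truncatedRegion N) := by
  have hL0 : 0 < L := by linarith
  have hT0 : 0 < T := by linarith
  have h2j : (1 : ℝ) ≤ 2 ^ j := one_le_pow₀ (by norm_num)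
  have h4j : (4 : ℝ) ^ j = 2 ^ j * 2 ^ j := by rw [← mul_pow]; norm_num
  have hQ : 1 ≤ 2 ^ j * L := by nlinarith
  set n := ⌊2 ^ j * L⌋₊ with hn
  have hn0 : 0 < n := Nat.floor_pos.2 hQ
  have hn1 : (n : ℝ) ≤ 2 ^ j * L := Nat.floor_le (by linarith)
  have hn2 : 2 ^ j * L ≤ n + 1 := (Nat.lt_floor_add_one _).le
  obtain ⟨ρ, hρ, hden⟩ := Real.exists_rat_abs_sub_le_and_den_le (N / x ^ 2 : ℝ) hn0
  have hq0 : (0 : ℝ) < ρ.den := by exact_mod_cast ρ.pos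
  have hcast : ((ρ : ℚ) : ℝ) = ρ.num / ρ.den := Rat.cast_def ρ
  rw [hcast] at hρ
  have hdq : 1 / ((n + 1) * ρ.den) * ρ.den = 1 / ((n : ℝ) + 1) := by field_simp
  have hinv : 1 / ((n : ℝ) + 1) ≤ 1 / (2 ^ j * L) := by gcongr
  have hqn : (ρ.den : ℝ) ≤ 2 ^ j * L := le_trans (by exact_mod_cast hden) hn1
  have hqinv : 1 / (ρ.den : ℝ) ≤ 4 ^ j / L := by
    by_contra hcon
    push Not at hcon
    apply hxa
    refine ⟨hx, ρ.den, Finset.mem_Icc.2 ⟨ρ.pos, ?_⟩, ρ.num, ?_⟩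
    · apply Nat.le_floor
      rw [le_div_iff₀ (by positivity)]
      rw [div_lt_div_iff₀ hL0 hq0] at hcon
      linarith
    · have : (ρ.den : ℝ) * (N / x ^ 2) - ρ.num = (N / x ^ 2 - ρ.num / ρ.den) * ρ.den := by
        field_simp
      rw [this, abs_mul, abs_of_pos hq0]
      calc _ ≤ 1 / ((n + 1) * ρ.den) * (ρ.den : ℝ) := by gcongr
        _ ≤ _ := by rw [hdq]; exact hinv
  have hsmall : 1 / (2 ^ j * L) ≤ 4 ^ j / L := by
    rw [div_le_div_iff₀ (by positivity) hL0, h4j]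
    nlinarith [mul_nonneg (mul_nonneg (sub_nonneg.2 h2j) hL0.le) (sub_nonneg.2 h2j), mul_le_mul h2j h2j (by norm_num) (by linarith), mul_le_mul (mul_le_mul h2j h2j (by norm_num) (by linarith)) h2j (by norm_num) (by positivity)]
  have hsq : (ρ.den : ℝ) ^ 2 ≤ 4 ^ j * L ^ 2 := by
    calc (ρ.den : ℝ) ^ 2 ≤ (2 ^ j * L) ^ 2 := by gcongr
      _ = _ := by rw [h4j]; ring
  refine mem_integerHull_of_slope (q := ρ.den) (a := ρ.num) (X := L * T)
    (d := 1 / ((n + 1) * ρ.den)) (e := 2 * (4 ^ j / L)) hT hTN (by nlinarith) ?_ hx ρ.pos ?_ ?_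
    hρ ?_ ?_ ?_ ?_ hyN
  · rw [← hTN]; nlinarith [mul_le_mul_of_nonneg_right hLT (sq_nonneg T)]
  · apply le_of_sq_le_sq _ (by positivity)
    refine hsq.trans ?_
    have h1 : (4 : ℝ) ^ j * L ^ 2 ≤ 9 / 4 * L * L ^ 2 := by gcongr
    have h2 : 9 * L ≤ T ^ 2 := by nlinarith
    nlinarith [mul_le_mul_of_nonneg_right h2 (sq_nonneg L)]
  · rw [Int.isCoprime_iff_gcd_eq_one]
    exact ρ.reduced
  · rw [hdq, div_le_one (by positivity)]; linarith
  · rw [← hTN, mul_pow, mul_div_assoc', div_le_div_iff₀ (by positivity) hL0]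
    have h1 : 2 * T ^ 3 * (ρ.den : ℝ) ^ 2 * L ≤ 2 * T ^ 3 * (4 ^ j * L ^ 2) * L := by gcongr
    linarith
  · rw [mul_div_assoc', div_le_iff₀ hL0]; linarith
  · rw [hdq]
    refine le_trans ?_ hy
    linarith

/-! ### Upper bound. -/

/-- The part of the truncated region missed by its integer hull. -/
def missedSet (N : ℕ) : Set (ℝ × ℝ) := truncatedRegion N \ integerHull (truncatedRegion N)

/-- Sorting missed points by height on the scale 4^j/L, level j has height O(4^j/L) over arcs of
total length O(LT/8^j), so its area is O(T/2^j). -/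
theorem volume_missedSet_block_le {N : ℕ} {T L : ℝ} (hT : 36 ≤ T)
    (hTN : T ^ 3 = N) (hL : 4 ≤ L) (hLT : L ^ 2 ≤ 4 * T) :
    volume {p ∈ missedSet N | p.1 ∈ Icc (L * T) (2 * (L * T))} ≤ ENNReal.ofReal (4612 * T) := by
  have hL0 : 0 < L := by linarith
  have hT0 : 0 < T := by linarith
  have hXN : (L * T) ^ 2 ≤ 4 * N := by
    rw [← hTN]; nlinarith [mul_le_mul_of_nonneg_right hLT (sq_nonneg T)]
  set J := ⌈9 / 4 * L⌉₊ with hJ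
  have hsub : {p ∈ missedSet N | p.1 ∈ Icc (L * T) (2 * (L * T))} ⊆
      hyperbolaStrip N (Icc (L * T) (2 * (L * T))) (4 / L) ∪ ⋃ j ∈ Finset.range J,
        hyperbolaStrip N (slopeArcs N (L * T) ⌊L / 4 ^ j⌋₊ (1 / (2 ^ j * L)))
          (16 * (4 ^ j / L)) := by
    rintro ⟨x, y⟩ ⟨⟨⟨⟨hx0, hy0, hxy⟩, ⟨hx1, hx2⟩, hy1, hy2⟩, hnot⟩, hx⟩
    simp only at hx0 hy0 hxy hx1 hx2 hy1 hy2 hx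
    have hfy : (N : ℝ) / x ≤ y := by rw [div_le_iff₀ hx0]; linarith
    have hlow : (cutLow N : ℝ) ≤ x := by
      have := (cutLow_bounds hT0 hTN).1
      nlinarith [hx.1]
    have h9 : y < N / x + 9 := by
      by_contra h
      exact hnot (mem_integerHull_of_add_nine_le (by linarith) hTN hlow hx2 (not_lt.1 h) hy2)
    by_cases hd : y ≤ N / x + 4 / L
    · exact Or.inl ⟨hx, hfy, hd⟩
    · right
      push Not at hd
      have h1 : 1 ≤ (y - N / x) * L / 4 := by
        rw [le_div_iff₀ (by norm_num), one_mul, ← div_le_iff₀ hL0]; linarith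
      obtain ⟨j, hj1, hj2⟩ := exists_nat_pow_near h1 (by norm_num : (1 : ℝ) < 4)
      -- The crude height bound 9 caps the number of levels.
      have hj3 : (4 : ℝ) ^ j ≤ 9 / 4 * L := by nlinarith
      simp only [mem_iUnion]
      refine ⟨j, ?_, ?_, hfy, ?_⟩
      · rw [Finset.mem_range, hJ, Nat.lt_ceil]
        refine lt_of_lt_of_le ?_ hj3
        have : j < 4 ^ j := Nat.lt_pow_self (by norm_num)
        exact_mod_cast this
      · by_contra hcon
        refine hnot (mem_integerHull_of_notMem_slopeArcs hT hTN hL hLT hj3 hx hcon ?_ hy2)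
        rw [le_div_iff₀ (by norm_num)] at hj1
        have : 4 * ((4 : ℝ) ^ j / L) ≤ y - N / x := by
          rw [mul_div_assoc', div_le_iff₀ hL0]; linarith
        linarith
      · rw [div_lt_iff₀ (by norm_num), pow_succ] at hj2
        have : y - N / x ≤ 16 * ((4 : ℝ) ^ j / L) := by
          rw [mul_div_assoc', le_div_iff₀ hL0]; linarith
        simp only; linarith
  have hterm : ∀ j : ℕ, volume (hyperbolaStrip N (slopeArcs N (L * T) ⌊L / 4 ^ j⌋₊
      (1 / (2 ^ j * L))) (16 * (4 ^ j / L))) ≤ ENNReal.ofReal (2304 * T * (1 / 2) ^ j) := by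
    intro j
    have h2j : (1 : ℝ) ≤ 2 ^ j := one_le_pow₀ (by norm_num)
    have h4j : (4 : ℝ) ^ j = 2 ^ j * 2 ^ j := by rw [← mul_pow]; norm_num
    have hw : 1 / (2 ^ j * L) < 1 := by
      rw [div_lt_one (by positivity)]; nlinarith
    refine (volume_hyperbolaStrip_le N _ _).trans ?_
    refine (mul_le_mul_right (volume_slopeArcs_le (by positivity) hXN (by positivity) hw) _).trans ?_
    rw [← ENNReal.ofReal_mul (by positivity)]
    apply ENNReal.ofReal_le_ofReal
    calc 16 * (4 ^ j / L) * (144 * (L * T) * ⌊L / 4 ^ j⌋₊ * (1 / (2 ^ j * L)))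
        ≤ 16 * (4 ^ j / L) * (144 * (L * T) * (L / 4 ^ j) * (1 / (2 ^ j * L))) := by
          gcongr
          exact Nat.floor_le (by positivity)
      _ = _ := by
          rw [one_div_pow]
          field_simp; ring
  refine (measure_mono hsub).trans ((measure_union_le _ _).trans ?_)
  have hbase : volume (hyperbolaStrip N (Icc (L * T) (2 * (L * T))) (4 / L)) ≤
      ENNReal.ofReal (4 * T) := by
    rw [volume_hyperbolaStrip N measurableSet_Icc, Real.volume_Icc,
      ← ENNReal.ofReal_mul (by positivity)]
    apply ENNReal.ofReal_le_ofReal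
    apply le_of_eq
    field_simp; ring
  have hsum : volume (⋃ j ∈ Finset.range J, hyperbolaStrip N
      (slopeArcs N (L * T) ⌊L / 4 ^ j⌋₊ (1 / (2 ^ j * L))) (16 * (4 ^ j / L))) ≤
      ENNReal.ofReal (4608 * T) := by
    refine (measure_biUnion_finset_le _ _).trans
      ((Finset.sum_le_sum fun j _ => hterm j).trans ?_)
    rw [← ENNReal.ofReal_sum_of_nonneg (fun j _ => by positivity), ← Finset.mul_sum]
    apply ENNReal.ofReal_le_ofReal
    have : ∑ j ∈ Finset.range J, (1 / 2 : ℝ) ^ j ≤ 2 := by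
      have h0 : (0 : ℝ) ≤ (1 / 2) ^ J := by positivity
      have h1 : ((1 / 2 : ℝ) ^ J - 1) / (1 / 2 - 1) = 2 - 2 * (1 / 2) ^ J := by ring
      rw [geom_sum_eq (by norm_num), h1]
      linarith
    nlinarith
  refine (add_le_add hbase hsum).trans (le_of_eq ?_)
  rw [← ENNReal.ofReal_add (by positivity) (by positivity)]
  congr 1; ring

theorem swap_mem_truncatedRegion {N : ℕ} {p : ℝ × ℝ} (h : p ∈ truncatedRegion N) :
    p.swap ∈ truncatedRegion N := by
  obtain ⟨⟨h1, h2, h3⟩, h4, h5⟩ := h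
  exact ⟨⟨h2, h1, by rw [mul_comm] at h3; exact h3⟩, h5, h4⟩

theorem swap_mem_integerHull {N : ℕ} {p : ℝ × ℝ} (h : p ∈ integerHull (truncatedRegion N)) :
    p.swap ∈ integerHull (truncatedRegion N) := by
  have hc : Convex ℝ ((LinearEquiv.prodComm ℝ ℝ ℝ).toLinearMap ⁻¹'
      integerHull (truncatedRegion N)) := (convex_convexHull ℝ _).linear_preimage _
  refine convexHull_min ?_ hc h
  rintro _ ⟨⟨z, rfl⟩, hz⟩
  exact subset_convexHull ℝ _ ⟨⟨z.swap, rfl⟩, swap_mem_truncatedRegion hz⟩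

theorem swap_mem_missedSet {N : ℕ} {p : ℝ × ℝ} (h : p ∈ missedSet N) : p.swap ∈ missedSet N :=
  ⟨swap_mem_truncatedRegion h.1, fun hp => h.2 (by simpa using swap_mem_integerHull hp)⟩

theorem volume_missedSet_le_two_mul (N : ℕ) :
    volume (missedSet N) ≤ 2 * volume {p ∈ missedSet N | p.1 ≤ p.2} := by
  have hmp : MeasurePreserving (MeasurableEquiv.prodComm : ℝ × ℝ ≃ᵐ ℝ × ℝ) volume volume :=
    Measure.measurePreserving_swap
  have hsub : missedSet N ⊆ {p ∈ missedSet N | p.1 ≤ p.2} ∪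
      (MeasurableEquiv.prodComm : ℝ × ℝ ≃ᵐ ℝ × ℝ) ⁻¹' {p ∈ missedSet N | p.1 ≤ p.2} := by
    intro p hp
    rcases le_total p.1 p.2 with h | h
    · exact Or.inl ⟨hp, h⟩
    · exact Or.inr ⟨swap_mem_missedSet hp, h⟩
  refine (measure_mono hsub).trans ((measure_union_le _ _).trans ?_)
  rw [hmp.measure_preimage_equiv, two_mul]

theorem volume_missedSet_le {N : ℕ} {T : ℝ} (hT : 36 ≤ T) (hTN : T ^ 3 = N) :
    volume (missedSet N) ≤ ENNReal.ofReal (27746 * (T * Real.log T)) := by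
  have hT0 : 0 < T := by linarith
  have hN : (0 : ℝ) < N := by rw [← hTN]; positivity
  obtain ⟨hl1, hl2⟩ := cutLow_bounds hT0 hTN
  have hl0 : (0 : ℝ) < cutLow N := by linarith
  obtain ⟨hh1, hh2⟩ := cutHigh_bounds N
  have hlog : 1 ≤ Real.log T := by
    rw [Real.le_log_iff_exp_le hT0]
    linarith [Real.exp_one_lt_d9]
  set K := ⌊2 * Real.log T⌋₊ + 1 with hK
  set B : ℕ → Set (ℝ × ℝ) := fun i =>
    {p ∈ missedSet N | p.1 ∈ Icc (4 * 2 ^ i * T) (2 * (4 * 2 ^ i * T))} with hB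
  classical
  set I := (Finset.range K).filter fun i => (4 * 2 ^ i : ℝ) ^ 2 ≤ 4 * T with hI
  -- The rectangle has height below 1, by the ceiling in `cutHigh`, and the strip has height 9; each
  -- has area O(T). Only the dyadic blocks produce the logarithm.
  have hsub : {p ∈ missedSet N | p.1 ≤ p.2} ⊆
      (Icc 0 (cutLow N : ℝ) ×ˢ Icc ((N : ℝ) / cutLow N) (cutHigh N : ℝ) ∪
        hyperbolaStrip N (Icc 0 (4 * T)) 9) ∪ ⋃ i ∈ I, B i := by
    rintro ⟨x, y⟩ ⟨hM, hle⟩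
    obtain ⟨⟨⟨hx0, hy0, hxy⟩, ⟨hx1, hx2⟩, hy1, hy2⟩, hnot⟩ := id hM
    simp only at hx0 hy0 hxy hx1 hx2 hy1 hy2 hle
    have hfy : (N : ℝ) / x ≤ y := by rw [div_le_iff₀ hx0]; linarith
    rcases le_total x (cutLow N) with hlow | hlow
    · refine Or.inl (Or.inl ⟨⟨hx0.le, hlow⟩, ?_, hy2⟩)
      refine le_trans ?_ hfy
      gcongr
    have h9 : y < N / x + 9 := by
      by_contra h
      exact hnot (mem_integerHull_of_add_nine_le (by linarith) hTN hlow hx2 (not_lt.1 h) hy2)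
    rcases le_total x (4 * T) with h4 | h4
    · exact Or.inl (Or.inr ⟨⟨hx0.le, h4⟩, hfy, h9.le⟩)
    right
    have hone : 1 ≤ x / (4 * T) := by rw [one_le_div (by positivity)]; exact h4
    obtain ⟨i, hi1, hi2⟩ := exists_nat_pow_near hone (by norm_num : (1 : ℝ) < 2)
    rw [le_div_iff₀ (by positivity)] at hi1
    rw [div_lt_iff₀ (by positivity), pow_succ] at hi2
    -- Below the diagonal bound x ≤ y < N/x + 9, so x is at most about √N.
    have hxsq : x ^ 2 ≤ 4 * T ^ 3 := by
      have h1 : x < N / x + 9 := hle.trans_lt h9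
      have h2 : x * x < N + 9 * x := by
        calc x * x < (N / x + 9) * x := by gcongr
          _ = _ := by field_simp
      rw [hTN]; nlinarith
    have hLT : (4 * 2 ^ i : ℝ) ^ 2 ≤ 4 * T := by
      have h1 : (4 * 2 ^ i * T : ℝ) ^ 2 ≤ x ^ 2 := by gcongr; linarith
      have h2 : (4 * 2 ^ i : ℝ) ^ 2 * T ^ 2 ≤ 4 * T * T ^ 2 := by
        rw [← mul_pow]; linarith
      exact le_of_mul_le_mul_right h2 (by positivity)
    have hiK : i < K := by
      rw [hK, Nat.lt_add_one_iff]
      apply Nat.le_floor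
      have h2i : (1 : ℝ) ≤ 2 ^ i := one_le_pow₀ (by norm_num)
      have h1 : (2 : ℝ) ^ i ≤ T := by nlinarith
      have h2 := Real.log_le_log (by positivity) h1
      rw [Real.log_pow] at h2
      have h3 := Real.log_two_gt_d9
      have h4 : (0 : ℝ) ≤ i := Nat.cast_nonneg i
      nlinarith
    simp only [mem_iUnion]
    refine ⟨i, Finset.mem_filter.2 ⟨Finset.mem_range.2 hiK, hLT⟩, hM, ?_, ?_⟩
    · simp only; linarith
    · simp only; linarith
  have h1 : volume (Icc 0 (cutLow N : ℝ) ×ˢ Icc ((N : ℝ) / cutLow N) (cutHigh N : ℝ)) ≤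
      ENNReal.ofReal T := by
    rw [Measure.volume_eq_prod, Measure.prod_prod, Real.volume_Icc, Real.volume_Icc,
      ← ENNReal.ofReal_mul (by linarith)]
    apply ENNReal.ofReal_le_ofReal
    nlinarith
  have h2 : volume (hyperbolaStrip N (Icc 0 (4 * T)) 9) ≤ ENNReal.ofReal (36 * T) := by
    rw [volume_hyperbolaStrip N measurableSet_Icc, Real.volume_Icc,
      ← ENNReal.ofReal_mul (by positivity)]
    apply ENNReal.ofReal_le_ofReal
    linarith
  have h3 : volume (⋃ i ∈ I, B i) ≤ ENNReal.ofReal (13836 * (T * Real.log T)) := by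
    have hterm : ∀ i ∈ I, volume (B i) ≤ ENNReal.ofReal (4612 * T) := fun i hi =>
      volume_missedSet_block_le hT hTN
        (by have : (1 : ℝ) ≤ 2 ^ i := one_le_pow₀ (by norm_num)
            linarith) (Finset.mem_filter.1 hi).2
    refine (measure_biUnion_finset_le _ _).trans ((Finset.sum_le_sum hterm).trans ?_)
    rw [Finset.sum_const, nsmul_eq_mul, ← ENNReal.ofReal_natCast,
      ← ENNReal.ofReal_mul (by positivity)]
    apply ENNReal.ofReal_le_ofReal
    have hcard : (I.card : ℝ) ≤ 3 * Real.log T := by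
      have a1 : I.card ≤ K := (Finset.card_filter_le _ _).trans (Finset.card_range K).le
      have a2 : (I.card : ℝ) ≤ K := by exact_mod_cast a1
      have a3 := Nat.floor_le (a := 2 * Real.log T) (by linarith)
      rw [hK] at a2
      push_cast at a2
      linarith
    nlinarith
  have hhalf : volume {p ∈ missedSet N | p.1 ≤ p.2} ≤
      ENNReal.ofReal (13873 * (T * Real.log T)) := by
    refine (measure_mono hsub).trans ((measure_union_le _ _).trans ?_)
    refine (add_le_add ((measure_union_le _ _).trans (add_le_add h1 h2)) h3).trans ?_
    rw [← ENNReal.ofReal_add (by positivity) (by positivity),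
      ← ENNReal.ofReal_add (by positivity) (by positivity)]
    apply ENNReal.ofReal_le_ofReal
    nlinarith
  refine (volume_missedSet_le_two_mul N).trans ((mul_le_mul_right hhalf 2).trans (le_of_eq ?_))
  rw [show (2 : ENNReal) = ENNReal.ofReal 2 by simp, ← ENNReal.ofReal_mul (by norm_num)]
  congr 1; ring

/-! ### Lower bound. -/

/-- The positive integers `m` for which the least integer above `N / m` exceeds it by at
most `η`. -/
def nearIntegerAbscissae (N : ℕ) (η : ℝ) : Set ℤ :=
  {m | 0 < m ∧ ∃ n : ℤ, (N : ℝ) / m ≤ n ∧ n - (N : ℝ) / m ≤ η}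

/-- With g = m' - m, the difference N/m - N/m' = gN/(mm') is within `η` of an integer, and N/(mm')
differs from N/x² by O(1/L²). -/
theorem mem_slopeArcs_of_close {N : ℕ} {T L x η : ℝ} (hT : 1 ≤ T) (hTN : T ^ 3 = N)
    (hL : 0 < L) (hη : η * L ≤ 1 / 10000) {m m' : ℤ}
    (hm : m ∈ nearIntegerAbscissae N η) (hm' : m' ∈ nearIntegerAbscissae N η) (hlt : m < m')
    (hclose : (m' : ℝ) - m ≤ L / 40) (hx : x ∈ Icc (L * T) (2 * (L * T)))
    (hmx : |(m : ℝ) - x| ≤ L / 4000 + L / 40) (hmx' : |(m' : ℝ) - x| ≤ L / 4000 + L / 40) :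
    x ∈ slopeArcs N (L * T) ⌊L / 40⌋₊ (13 / (1000 * L)) := by
  obtain ⟨hm0, n, hn1, hn2⟩ := hm
  obtain ⟨hm0', n', hn1', hn2'⟩ := hm'
  obtain ⟨g, hg⟩ := Int.eq_ofNat_of_zero_le (sub_nonneg.2 hlt.le)
  have hgR : (m' : ℝ) - m = g := by exact_mod_cast hg
  have hg1 : 1 ≤ g := by omega
  have hg1' : (1 : ℝ) ≤ g := by exact_mod_cast hg1
  have hmR : (0 : ℝ) < m := by exact_mod_cast hm0
  have hmR' : (0 : ℝ) < m' := by exact_mod_cast hm0'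
  have hX0 : 0 < L * T := by positivity
  have hLX : L ≤ L * T := by nlinarith
  have hx0 : 0 < x := by linarith [hx.1]
  have hN : (0 : ℝ) < N := by rw [← hTN]; positivity
  have a1 := abs_le.1 hmx
  have a2 := abs_le.1 hmx'
  refine ⟨hx, g, Finset.mem_Icc.2 ⟨hg1, Nat.le_floor (by linarith)⟩, n - n', ?_⟩
  have hprod : (g : ℝ) * (N / (m * m')) = N / m - N / m' := by
    rw [← hgR]; field_simp
  have hdiff : |(N : ℝ) / x ^ 2 - N / (m * m')| ≤ 101 / 200 / L ^ 2 := by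
    have h1 : (N : ℝ) / x ^ 2 - N / (m * m')
        = -(N * (x * (x - m) + m * (x - m')) / (x ^ 2 * (m * m'))) := by
      field_simp; ring
    rw [h1, abs_neg, abs_div, abs_mul, abs_of_pos hN,
      abs_of_pos (a := x ^ 2 * (m * m' : ℝ)) (by positivity), div_le_div_iff₀ (by positivity)
      (by positivity)]
    have h2 : |x * (x - m) + m * (x - m')| ≤ 5 * (L * T) * (L / 4000 + L / 40) := by
      refine (abs_add_le _ _).trans ?_
      rw [abs_mul, abs_mul, abs_of_pos hx0, abs_of_pos hmR, abs_sub_comm x, abs_sub_comm x]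
      have e1 : x * |(m : ℝ) - x| ≤ 2 * (L * T) * (L / 4000 + L / 40) := by
        gcongr
        exact hx.2
      have e2 : (m : ℝ) * |(m' : ℝ) - x| ≤ 3 * (L * T) * (L / 4000 + L / 40) := by
        gcongr
        linarith [hx.2]
      linarith
    have h3 : (L * T) ^ 2 * ((L * T / 2) * (L * T / 2)) ≤ x ^ 2 * (m * m') := by
      gcongr
      · exact hx.1
      · linarith [hx.1]
      · linarith [hx.1]
    have h4 : N * |x * (x - m) + m * (x - m')| * L ^ 2
        ≤ N * (5 * (L * T) * (L / 4000 + L / 40)) * L ^ 2 := by gcongr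
    refine h4.trans (le_trans (le_of_eq ?_) (mul_le_mul_of_nonneg_left h3 (by norm_num)))
    rw [← hTN]; ring
  have hg40 : (g : ℝ) ≤ L / 40 := by linarith
  have hmul : (g : ℝ) * |(N : ℝ) / x ^ 2 - N / (m * m')| ≤ 101 / 8000 / L := by
    calc (g : ℝ) * |(N : ℝ) / x ^ 2 - N / (m * m')| ≤ L / 40 * (101 / 200 / L ^ 2) := by gcongr
      _ = _ := by field_simp; norm_num
  have heq : (g : ℝ) * (N / x ^ 2) - ((n - n' : ℤ) : ℝ)
      = g * ((N : ℝ) / x ^ 2 - N / (m * m')) - ((n - N / m) - (n' - N / m')) := by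
    rw [mul_sub, hprod]; push_cast; ring
  have hηL : η ≤ 1 / 10000 / L := by rw [le_div_iff₀ hL]; exact hη
  rw [heq]
  refine (abs_sub _ _).trans ?_
  rw [abs_mul, Nat.abs_cast]
  have h5 : |((n : ℝ) - N / m) - (n' - N / m')| ≤ η := by
    rw [abs_le]; constructor <;> linarith
  have h6 : (13 : ℝ) / (1000 * L) = 101 / 8000 / L + 3 / 8000 / L := by field_simp; norm_num
  have h7 : 1 / 10000 / L ≤ 3 / 8000 / L := by
    rw [div_le_div_iff_of_pos_right hL]; norm_num
  linarith

/-- The points of `[X, 2X]`, `X = L T`, that lie near an element of `nearIntegerAbscissae`. -/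
def nearAbscissaSet (N : ℕ) (T L η : ℝ) : Set ℝ :=
  {x | x ∈ Icc (L * T) (2 * (L * T)) ∧ ∃ m ∈ nearIntegerAbscissae N η, |(m : ℝ) - x| ≤ L / 4000}

/-- Abscissae with a neighbour within L/40 are absorbed by `slopeArcs`; the remaining ones are
L/40-separated, so there are O(T) of them, each covering an interval of length L/2000. -/
theorem volume_nearAbscissaSet_le {N : ℕ} {T L η : ℝ} (hT : 1 ≤ T) (hTN : T ^ 3 = N)
    (hL : 1 ≤ L) (hLT : L ^ 2 ≤ 4 * T) (hη : η * L ≤ 1 / 10000) :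
    volume (nearAbscissaSet N T L η) ≤ ENNReal.ofReal (L * T / 2) := by
  have hL0 : 0 < L := by linarith
  have hLX : L ≤ L * T := by nlinarith
  classical
  set S : Finset ℤ := (Finset.Icc 0 ⌊3 * (L * T)⌋).filter fun m =>
    m ∈ nearIntegerAbscissae N η ∧
      ∀ m' ∈ nearIntegerAbscissae N η, |(m' : ℝ) - m| ≤ L / 40 → m' = m with hS
  have hsub : nearAbscissaSet N T L η ⊆ slopeArcs N (L * T) ⌊L / 40⌋₊ (13 / (1000 * L)) ∪
      ⋃ m ∈ S, Icc ((m : ℝ) - L / 4000) (m + L / 4000) := by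
    rintro x ⟨hx, m, hm, hmx⟩
    have hmx' := abs_le.1 hmx
    by_cases hiso : ∀ m' ∈ nearIntegerAbscissae N η, |(m' : ℝ) - m| ≤ L / 40 → m' = m
    · right
      simp only [mem_iUnion]
      refine ⟨m, Finset.mem_filter.2 ⟨Finset.mem_Icc.2 ⟨hm.1.le, ?_⟩, hm, hiso⟩, ?_, ?_⟩
      · rw [Int.le_floor]; linarith [hx.2]
      · linarith
      · linarith
    · left
      push Not at hiso
      obtain ⟨m', hm', hmm, hne⟩ := hiso
      have hmm' := abs_le.1 hmm
      rcases lt_or_gt_of_ne hne with h | h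
      · exact mem_slopeArcs_of_close hT hTN hL0 hη hm' hm h (by linarith) hx
          (by rw [abs_le]; constructor <;> linarith) (by linarith)
      · exact mem_slopeArcs_of_close hT hTN hL0 hη hm hm' h (by linarith) hx
          (by linarith) (by rw [abs_le]; constructor <;> linarith)
  have hcard : (S.card : ℝ) ≤ 121 * T := by
    have h1 : S.card ≤ (Finset.Icc (0 : ℤ) ⌊120 * T⌋).card := by
      refine Finset.card_le_card_of_injOn (fun m : ℤ => ⌊(m : ℝ) / (L / 40)⌋) ?_ ?_
      · intro m hm
        obtain ⟨hm1, -⟩ := Finset.mem_filter.1 hm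
        obtain ⟨hm2, hm3⟩ := Finset.mem_Icc.1 hm1
        have hm2' : (0 : ℝ) ≤ m := by exact_mod_cast hm2
        rw [Int.le_floor] at hm3
        simp only [Finset.coe_Icc, mem_Icc]
        refine ⟨Int.floor_nonneg.2 (by positivity), Int.floor_le_floor ?_⟩
        rw [div_le_iff₀ (by positivity)]
        linarith
      · intro m hm m' hm' heq
        obtain ⟨-, hm1, -⟩ := Finset.mem_filter.1 hm
        obtain ⟨-, -, hm2⟩ := Finset.mem_filter.1 hm'
        refine hm2 m hm1 ?_
        have := Int.abs_sub_lt_one_of_floor_eq_floor heq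
        rw [← sub_div, abs_div, abs_of_pos (a := L / 40) (by positivity),
          div_lt_one (by positivity)] at this
        exact this.le
    have h2 : ((Finset.Icc (0 : ℤ) ⌊120 * T⌋).card : ℝ) ≤ 120 * T + 1 := by
      rw [Int.card_Icc, sub_zero]
      have h0 : (0 : ℤ) ≤ ⌊120 * T⌋ + 1 := by
        have : (0 : ℤ) ≤ ⌊120 * T⌋ := Int.floor_nonneg.2 (by positivity)
        omega
      have h3 : (((⌊120 * T⌋ + 1).toNat : ℤ) : ℝ) = ((⌊120 * T⌋ + 1 : ℤ) : ℝ) := by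
        rw [Int.toNat_of_nonneg h0]
      rw [Int.cast_natCast] at h3
      rw [h3]; push_cast
      linarith [Int.floor_le (120 * T)]
    have h3 : (S.card : ℝ) ≤ ((Finset.Icc (0 : ℤ) ⌊120 * T⌋).card : ℝ) := by exact_mod_cast h1
    linarith
  have hXN : (L * T) ^ 2 ≤ 4 * N := by
    rw [← hTN]; nlinarith [mul_le_mul_of_nonneg_right hLT (sq_nonneg T)]
  have hv1 : volume (slopeArcs N (L * T) ⌊L / 40⌋₊ (13 / (1000 * L))) ≤
      ENNReal.ofReal (L * T / 4) := by
    refine (volume_slopeArcs_le (by positivity) hXN (by positivity) ?_).trans ?_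
    · rw [div_lt_one (by positivity)]; linarith
    apply ENNReal.ofReal_le_ofReal
    calc 144 * (L * T) * (⌊L / 40⌋₊ : ℝ) * (13 / (1000 * L))
        ≤ 144 * (L * T) * (L / 40) * (13 / (1000 * L)) := by
          gcongr
          exact Nat.floor_le (by positivity)
      _ = 144 * 13 / 40000 * (L * T) := by field_simp; norm_num
      _ ≤ _ := by linarith
  have hv2 : volume (⋃ m ∈ S, Icc ((m : ℝ) - L / 4000) (m + L / 4000)) ≤
      ENNReal.ofReal (L * T / 4) := by
    refine (measure_biUnion_finset_le _ _).trans ?_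
    simp_rw [Real.volume_Icc, show ∀ m : ℝ, m + L / 4000 - (m - L / 4000) = L / 2000 by
      intro m; ring]
    rw [Finset.sum_const, nsmul_eq_mul, ← ENNReal.ofReal_natCast,
      ← ENNReal.ofReal_mul (by positivity)]
    apply ENNReal.ofReal_le_ofReal
    have := mul_le_mul_of_nonneg_right hcard (by positivity : 0 ≤ L / 2000)
    nlinarith
  refine (measure_mono hsub).trans ((measure_union_le _ _).trans
    ((add_le_add hv1 hv2).trans (le_of_eq ?_)))
  rw [← ENNReal.ofReal_add (by positivity) (by positivity)]
  congr 1; ring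

theorem le_volume_missedSet_block {N : ℕ} {T L : ℝ} (hTN : T ^ 3 = N)
    (hL : 4 ≤ L) (hLT : L ^ 2 ≤ T) :
    ENNReal.ofReal (T / 768000000) ≤
      volume (Prod.fst ⁻¹' Ico (L * T) (2 * (L * T)) ∩ missedSet N) := by
  have hL0 : 0 < L := by linarith
  have hT16 : 16 ≤ T := by nlinarith
  have hT0 : 0 < T := by linarith
  have hN : (0 : ℝ) < N := by rw [← hTN]; positivity
  -- The largest value allowed by r = L/4000 and the bound x²(x + r) ≤ 12(LT)³.
  set η := 1 / (192000000 * L) with hη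
  have hη0 : 0 < η := by positivity
  have hηL : η * L = 1 / 192000000 := by rw [hη]; field_simp
  have hη1 : η ≤ 1 := by nlinarith
  set U := toMeasurable volume (nearAbscissaSet N T L η) with hU
  have hUvol : volume U ≤ ENNReal.ofReal (L * T / 2) := by
    rw [hU, measure_toMeasurable]
    exact volume_nearAbscissaSet_le (by linarith) hTN (by linarith) (by linarith)
      (by rw [hηL]; norm_num)
  have hE : MeasurableSet (Ico (L * T) (2 * (L * T)) \ U) :=
    measurableSet_Ico.diff (measurableSet_toMeasurable _ _)
  have hEvol : ENNReal.ofReal (L * T / 2) ≤ volume (Ico (L * T) (2 * (L * T)) \ U) := by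
    refine le_trans ?_ le_measure_sdiff
    refine le_trans ?_ (tsub_le_tsub_left hUvol _)
    rw [Real.volume_Ico, ← ENNReal.ofReal_sub _ (by positivity)]
    apply ENNReal.ofReal_le_ofReal
    linarith
  have hN2 := sq_le_cutHigh (by linarith) hTN
  have hsub : hyperbolaStrip N (Ico (L * T) (2 * (L * T)) \ U) (η / 2) ⊆
      Prod.fst ⁻¹' Ico (L * T) (2 * (L * T)) ∩ missedSet N := by
    rintro ⟨x, y⟩ ⟨⟨hx, hxU⟩, hy1, hy2⟩
    simp only at hx hxU hy1 hy2
    have hX : 0 < L * T := by positivity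
    have hx0 : 0 < x := by linarith [hx.1]
    have hxnear : x ∉ nearAbscissaSet N T L η := fun h => hxU (subset_toMeasurable _ _ h)
    have hNx1 : (N : ℝ) / x ≤ T ^ 2 / 4 := by
      rw [div_le_iff₀ hx0, ← hTN]
      have : T ^ 2 / 4 * (4 * T) ≤ T ^ 2 / 4 * x := by
        gcongr
        nlinarith [hx.1]
      linarith
    have h2LT : 2 * L ≤ T := by nlinarith
    have hNx2 : 1 ≤ (N : ℝ) / x := by
      rw [le_div_iff₀ hx0, ← hTN]
      nlinarith [hx.2]
    have hy0 : 0 < y := by linarith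
    refine ⟨hx, ⟨⟨hx0, hy0, ?_⟩, ⟨?_, ?_⟩, ?_, ?_⟩, ?_⟩
    · rw [div_le_iff₀ hx0] at hy1; simp only; linarith
    · simp only; nlinarith [hx.1]
    · simp only; nlinarith [hx.2]
    · simp only; linarith
    · simp only; nlinarith
    · refine notMem_integerHull_of_gap (r := L / 4000) (η := η) hx0 (by positivity) ?_ ?_
        (by linarith) _ inter_subset_left
      · have h1 : x + L / 4000 ≤ 3 * (L * T) := by nlinarith [hx.2]
        calc η * (x ^ 2 * (x + L / 4000)) ≤ η * ((2 * (L * T)) ^ 2 * (3 * (L * T))) := by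
              gcongr
              exact hx.2.le
          _ = η * L * (12 * L ^ 2 * T ^ 3) := by ring
          _ = _ := by rw [hηL, ← hTN]; ring
      · intro m n hm hmx hmn
        by_contra hcon
        exact hxnear ⟨⟨hx.1, hx.2.le⟩, m, ⟨hm, n, hmn, not_lt.1 hcon⟩, hmx⟩
  refine le_trans ?_ (measure_mono hsub)
  rw [volume_hyperbolaStrip N hE]
  refine le_trans ?_ (mul_le_mul_right hEvol _)
  rw [← ENNReal.ofReal_mul (by positivity)]
  apply ENNReal.ofReal_le_ofReal
  rw [hη]
  apply le_of_eq
  field_simp; norm_num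

theorem le_volume_missedSet {N : ℕ} {T : ℝ} (hT : 256 ≤ T) (hTN : T ^ 3 = N) :
    ENNReal.ofReal (1 / 2304000000 * (T * Real.log T)) ≤ volume (missedSet N) := by
  have hT0 : 0 < T := by linarith
  have hone : 1 ≤ T / 16 := by linarith
  obtain ⟨n, hn1, hn2⟩ := exists_nat_pow_near hone (by norm_num : (1 : ℝ) < 4)
  set f : ℕ → ℝ := fun i => 4 * 2 ^ i * T with hf
  have hfmono : Monotone f := monotone_nat_of_le_succ fun i => by
    have : (0 : ℝ) < 2 ^ i * T := by positivity
    simp only [hf, pow_succ]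
    linarith
  set B : ℕ → Set (ℝ × ℝ) := fun i => Prod.fst ⁻¹' Ico (f i) (2 * f i) with hB
  have hdisj : Pairwise (Function.onFun Disjoint B) := by
    intro i j hij
    refine Disjoint.preimage _ ?_
    have := hfmono.pairwise_disjoint_on_Ico_succ hij
    have hs : ∀ k, f (Order.succ k) = 2 * f k := fun k => by
      simp only [hf, Nat.succ_eq_succ, pow_succ]; ring
    simpa only [Function.onFun, hs] using this
  have hBm : ∀ i, MeasurableSet (B i) := fun i => measurable_fst measurableSet_Ico
  have hterm : ∀ i ∈ Finset.range (n + 1),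
      ENNReal.ofReal (T / 768000000) ≤ (volume.restrict (missedSet N)) (B i) := by
    intro i hi
    -- Restricting the measure makes additivity depend only on measurability of the blocks.
    rw [Measure.restrict_apply (hBm i)]
    have h2i : (1 : ℝ) ≤ 2 ^ i := one_le_pow₀ (by norm_num)
    refine le_volume_missedSet_block hTN (by linarith) ?_
    have hin : i ≤ n := Nat.lt_add_one_iff.1 (Finset.mem_range.1 hi)
    calc (4 * 2 ^ i : ℝ) ^ 2 = 16 * 4 ^ i := by
          rw [mul_pow, ← pow_mul, mul_comm i 2, pow_mul]; norm_num
      _ ≤ 16 * 4 ^ n := by gcongr; norm_num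
      _ ≤ T := by linarith
  have hlog : Real.log T / 3 ≤ (n + 1 : ℕ) := by
    -- `256 ≤ T` gives T ≤ (T/16)², and log 16 < 3 then yields the block count.
    have h1 : T ≤ 16 ^ (n + 1) := by
      calc T ≤ (T / 16) ^ 2 := by nlinarith
        _ ≤ (4 ^ (n + 1)) ^ 2 := by gcongr
        _ = _ := by rw [← pow_mul, mul_comm, pow_mul]; norm_num
    have h2 := Real.log_le_log hT0 h1
    rw [Real.log_pow, show (16 : ℝ) = 2 ^ 4 by norm_num, Real.log_pow] at h2
    have h3 := Real.log_two_lt_d9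
    have h4 : (0 : ℝ) ≤ (n + 1 : ℕ) := Nat.cast_nonneg _
    push_cast at *
    nlinarith
  calc ENNReal.ofReal (1 / 2304000000 * (T * Real.log T))
      ≤ ENNReal.ofReal ((n + 1 : ℕ) * (T / 768000000)) := by
        apply ENNReal.ofReal_le_ofReal
        have := mul_le_mul_of_nonneg_right hlog (by positivity : 0 ≤ T / 768000000)
        linarith
    _ = ∑ i ∈ Finset.range (n + 1), ENNReal.ofReal (T / 768000000) := by
        rw [Finset.sum_const, Finset.card_range, nsmul_eq_mul, ENNReal.ofReal_mul (by positivity),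
          ENNReal.ofReal_natCast]
    _ ≤ ∑ i ∈ Finset.range (n + 1), (volume.restrict (missedSet N)) (B i) :=
        Finset.sum_le_sum hterm
    _ = (volume.restrict (missedSet N)) (⋃ i ∈ Finset.range (n + 1), B i) :=
        (measure_biUnion_finset (fun i _ j _ hij => hdisj hij) fun i _ => hBm i).symm
    _ ≤ (volume.restrict (missedSet N)) univ := measure_mono (subset_univ _)
    _ = volume (missedSet N) := Measure.restrict_apply_univ _

/-! ### Finiteness, positivity, and passage to all N. -/

theorem volume_missedSet_lt_top (N : ℕ) : volume (missedSet N) < ⊤ := by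
  refine (measure_mono (t := Icc (1 : ℝ) (cutHigh N : ℝ) ×ˢ Icc (1 : ℝ) (cutHigh N : ℝ))
    fun p hp => hp.1.2).trans_lt ?_
  rw [Measure.volume_eq_prod, Measure.prod_prod, Real.volume_Icc]
  exact ENNReal.mul_lt_top ENNReal.ofReal_lt_top ENNReal.ofReal_lt_top

theorem one_le_cubeRoot_and_pow_three {N : ℕ} (hN : 1 ≤ N) :
    1 ≤ (N : ℝ) ^ (1 / 3 : ℝ) ∧ ((N : ℝ) ^ (1 / 3 : ℝ)) ^ 3 = N := by
  have h1 : (1 : ℝ) ≤ N := by exact_mod_cast hN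
  refine ⟨Real.one_le_rpow h1 (by norm_num), ?_⟩
  rw [← Real.rpow_natCast, ← Real.rpow_mul (by linarith)]
  norm_num

/-- Midway between the integer abscissae `cutLow N` and its successor there is no lattice column
within 1/4, so the gap criterion holds vacuously. -/
theorem volume_missedSet_pos {N : ℕ} (hN2 : 2 ≤ N) : 0 < volume (missedSet N) := by
  obtain ⟨hT, hTN⟩ := one_le_cubeRoot_and_pow_three (N := N) (by omega)
  set T := (N : ℝ) ^ (1 / 3 : ℝ)
  have hN : (2 : ℝ) ≤ N := by exact_mod_cast hN2
  have hl1 := (cutLow_bounds (by linarith) hTN).1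
  have hk : 1 ≤ cutLow N := one_le_cutLow hT hTN
  have hh1 := (cutHigh_bounds N).1
  set k := cutLow N
  have hkR : (1 : ℝ) ≤ k := by exact_mod_cast hk
  have hk3 : (k : ℝ) ^ 3 ≤ N := by rw [← hTN]; gcongr
  have hkk : (k : ℝ) * k < N := by
    rcases eq_or_lt_of_le hk with h | h
    · rw [← h]; norm_num; linarith
    · have : (2 : ℝ) ≤ k := by exact_mod_cast h
      nlinarith
  have hkM : (k : ℝ) + 1 ≤ cutHigh N := by
    have h1 : (k : ℝ) < cutHigh N := by
      refine lt_of_lt_of_le ?_ hh1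
      rw [lt_div_iff₀ (by linarith)]; exact hkk
    exact_mod_cast h1
  have hkN : (k : ℝ) + 1 ≤ N := by
    have h1 : (k : ℝ) < N := by nlinarith
    exact_mod_cast h1
  set η : ℝ := N / (16 * ((k + 1) ^ 2 * (k + 2))) with hη
  have hη0 : 0 < η := by positivity
  have hgap : (N : ℝ) / (k + 3 / 8) < N / k := by gcongr; linarith
  -- The second bound keeps the strip below height N/k, hence inside the square.
  obtain ⟨h, hh0, hh⟩ := exists_between (lt_min hη0 (sub_pos.2 hgap))
  have hhη := hh.trans_le (min_le_left _ _)
  have hhk := hh.trans_le (min_le_right _ _)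
  have hsub : hyperbolaStrip N (Icc (k + 3 / 8) (k + 5 / 8)) h ⊆ missedSet N := by
    rintro ⟨x, y⟩ ⟨⟨hx1, hx2⟩, hy1, hy2⟩
    simp only at hx1 hx2 hy1 hy2
    have hx0 : 0 < x := by linarith
    have hNx1 : 1 ≤ (N : ℝ) / x := by rw [le_div_iff₀ hx0]; linarith
    have hNx2 : (N : ℝ) / x ≤ N / (k + 3 / 8) := by gcongr
    refine ⟨⟨⟨hx0, by simp only; linarith, ?_⟩, ⟨by simp only; linarith, by simp only; linarith⟩,
      by simp only; linarith, by simp only; linarith⟩, ?_⟩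
    · rw [div_le_iff₀ hx0] at hy1; simp only; linarith
    · refine notMem_integerHull_of_gap (r := 1 / 4) (η := η) hx0 (by norm_num) ?_ ?_
        (by linarith) _ inter_subset_left
      · have e1 : x ≤ k + 1 := by linarith
        have e2 : x + 1 / 4 ≤ k + 2 := by linarith
        calc η * (x ^ 2 * (x + 1 / 4)) ≤ η * ((k + 1) ^ 2 * (k + 2)) := by gcongr
          _ = _ := by rw [hη]; field_simp; norm_num
      · intro m n _ hmx _
        have hmx' := abs_le.1 hmx
        have h1 : (k : ℝ) < m := by linarith
        have h2 : (m : ℝ) < k + 1 := by linarith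
        have h1' : (k : ℤ) < m := by exact_mod_cast h1
        have h2' : m < (k : ℤ) + 1 := by exact_mod_cast h2
        omega
  refine lt_of_lt_of_le ?_ (measure_mono hsub)
  rw [volume_hyperbolaStrip N measurableSet_Icc, Real.volume_Icc]
  refine ENNReal.mul_pos ?_ ?_
  · simpa using hh0
  · have : (0 : ℝ) < k + 5 / 8 - (k + 3 / 8) := by ring_nf; norm_num
    simpa using this

/-- An eventual two-sided comparison of positive sequences can be extended to all indices. -/
theorem exists_strict_bounds_of_eventually {a : ℕ} {A h : ℕ → ℝ} (hA : ∀ n, a ≤ n → 0 < A n)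
    (hh : ∀ n, a ≤ n → 0 < h n) (n₀ : ℕ)
    (hbd : ∃ c C : ℝ, 0 < c ∧ 0 < C ∧ ∀ n, a ≤ n → n₀ ≤ n → c * h n < A n ∧ A n < C * h n) :
    ∃ c C : ℝ, 0 < c ∧ 0 < C ∧ ∀ n, a ≤ n → c * h n < A n ∧ A n < C * h n := by
  induction n₀ with
  | zero => simpa using hbd
  | succ k ih =>
    apply ih
    obtain ⟨c, C, hc, hC, H⟩ := hbd
    by_cases hk : a ≤ k
    · have hAk := hA k hk
      have hhk := hh k hk
      refine ⟨min c (A k / h k / 2), max C (2 * (A k / h k)), by positivity, by positivity, ?_⟩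
      intro n hn hkn
      have hhn := hh n hn
      rcases eq_or_lt_of_le hkn with rfl | hlt
      · constructor
        · refine (mul_le_mul_of_nonneg_right (min_le_right _ _) hhk.le).trans_lt ?_
          have : A k / h k / 2 * h k = A k / 2 := by field_simp
          linarith
        · refine lt_of_lt_of_le ?_ (mul_le_mul_of_nonneg_right (le_max_right _ _) hhk.le)
          have : 2 * (A k / h k) * h k = 2 * A k := by field_simp
          linarith
      · obtain ⟨h1, h2⟩ := H n hn hlt
        exact ⟨(mul_le_mul_of_nonneg_right (min_le_left _ _) hhn.le).trans_lt h1,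
          h2.trans_le (mul_le_mul_of_nonneg_right (le_max_left _ _) hhn.le)⟩
    · refine ⟨c, C, hc, hC, fun n hn hkn => H n hn ?_⟩
      omega

theorem theorem3 :
    ∃ c C : ℝ, 0 < c ∧ 0 < C ∧ ∀ N : ℕ, 2 ≤ N →
      c * ((N : ℝ) ^ (1 / 3 : ℝ) * Real.log N) < missedArea N ∧
        missedArea N < C * ((N : ℝ) ^ (1 / 3 : ℝ) * Real.log N) := by
  have hpos : ∀ N : ℕ, 2 ≤ N → 0 < (N : ℝ) ^ (1 / 3 : ℝ) * Real.log N := fun N hN => by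
    have : (2 : ℝ) ≤ N := by exact_mod_cast hN
    exact mul_pos (by positivity) (Real.log_pos (by linarith))
  refine exists_strict_bounds_of_eventually
    (fun N hN => ENNReal.toReal_pos (volume_missedSet_pos hN).ne' (volume_missedSet_lt_top N).ne)
    hpos (256 ^ 3) ⟨1 / 10000000000, 27746, by norm_num, by norm_num, fun N hN hN0 => ?_⟩
  obtain ⟨hT1, hTN⟩ := one_le_cubeRoot_and_pow_three (N := N) (by omega)
  have hp := hpos N hN
  set T := (N : ℝ) ^ (1 / 3 : ℝ)
  have hT : 256 ≤ T := by
    refine le_of_pow_le_pow_left₀ (n := 3) (by norm_num) (by linarith) ?_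
    rw [hTN]; exact_mod_cast hN0
  have hlog : Real.log N = 3 * Real.log T := by rw [← hTN, Real.log_pow]; norm_num
  have hfin := (volume_missedSet_lt_top N).ne
  have hlow := (ENNReal.ofReal_le_iff_le_toReal hfin).1 (le_volume_missedSet hT hTN)
  have hlogT : 0 < Real.log T := Real.log_pos (by linarith)
  have hup := ENNReal.toReal_le_of_le_ofReal (by positivity)
    (volume_missedSet_le (by linarith) hTN)
  change _ < (volume (missedSet N)).toReal ∧ (volume (missedSet N)).toReal < _
  rw [hlog] at hp ⊢
  constructor <;> nlinarith
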